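/- For a set $S\subseteq\mathbb{F}_p$ ($p$ prime) write $(S\circ S)(x)=|\{(y,z)\in S\times S: z-y=x\}|$ and $E^+(S)=|\{(a_1,a_2,b_1,b_2)\in S^4: a_1+b_1=a_2+b_2\}|$; logarithms are to base $2$. Let $A,\Gamma$ be subgroups of the multiplicative group $\mathbb{F}_p^*$, let $\xi\in\mathbb{F}_p^*$, and suppose that $A-A=\xi\Gamma\sqcup\{0\}$ and that $(A\circ A)(x)=c$ for all $x\in\xi\Gamma$, where $c$ is a constant. (i) There are absolute constants $K,\kappa>0$ (independent of $p,A,\Gamma,\xi,c$) such that always $|A|^2-|A|=c|\Gamma|$, and either $|\Gamma|\le K$ or $|\Gamma|\ge \kappa\, p/\log p$. (ii) For every $\delta>0$ there is a constant $C>0$, depending only on $\delta$, such that if $\Gamma\ne\mathbb{F}_p^*$ and $|\Gamma|\ge\delta\,p/\log p$, then $$E^+(A)\le C\,\frac{|\Gamma|}{p}\,|A|^2\log|A|\qquad\text{and}\qquad c^2\le C\,\frac{|A|^2\log|A|}{p}.$$ -/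

import Mathlib

open scoped Pointwise

/-- The elements of a multiplicative subgroup of `𝔽_p^*`, as a finite subset of `𝔽_p`. -/
noncomputable def elems {p : ℕ} [Fact p.Prime] (H : Subgroup (ZMod p)ˣ) : Finset (ZMod p) :=
  (Set.toFinite ((fun u : (ZMod p)ˣ => (u : ZMod p)) '' (H : Set (ZMod p)ˣ))).toFinset

/-- The characteristic function of a subset of `𝔽_p`. -/
def charFn {p : ℕ} (S : Finset (ZMod p)) : ZMod p → ℝ :=
  fun x => if x ∈ S then 1 else 0

/-- `(f ∘ g)(x) = ∑_y f(y) g(y + x)`. -/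
noncomputable def correlation {p : ℕ} [Fact p.Prime] (f g : ZMod p → ℝ) (x : ZMod p) : ℝ :=
  ∑ y : ZMod p, f y * g (y + x)

/-- `A - A = ξ Γ ⊔ {0}` with `ξ ≠ 0` (the union is then automatically disjoint), and `A ∘ A` is
equal to the constant `c` on `ξ Γ`. -/
def IsConstDifference {p : ℕ} [Fact p.Prime] (A Γ : Subgroup (ZMod p)ˣ) (ξ : ZMod p) (c : ℝ) :
    Prop :=
  ξ ≠ 0 ∧ elems A - elems A = ξ • elems Γ ∪ {0} ∧
    ∀ x ∈ ξ • elems Γ, correlation (charFn (elems A)) (charFn (elems A)) x = c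

/-! Put Q = Γ ∩ (1 − Γ). Nonzero differences of elements of A lie in ξΓ, so their ratios lie in Γ,
and (u − 1)/(v − 1) ∈ Q for distinct u, v ∈ A∖{1}. By Cauchy–Schwarz, |A|^4 ≪ |Q|·E, where E is the
multiplicative energy of A − 1 over ratios other than 0 and 1. Stepanov's method gives E ≪ |A|²
log|A| once |A|² ≤ p, which holds when Γ ≠ 𝔽_p^*. Hence |A|² ≪ |Q| log|A|
(`IsConstDifference.card_sq_le`).

Q is bounded in two ways. If |Γ| ≪ p^{3/4}, Stepanov gives |Q| ≪ |Γ|^{2/3}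
(`card_unit_sums_cube_le`); as c ≥ 1 forces |Γ| ≤ |A|², this makes |A| bounded. Otherwise point-line
incidences give |Q| ≤ |Γ|²/p + √p ≪ |Γ|²/p (`card_unit_sums_le`), so p|A|² ≪ |Γ|² log|A|. Inserting
|Γ| ≤ |A|² yields |Γ| ≫ p/log p, and (ii) follows from E^+(A) = |A|² + c²|Γ| and c|Γ| ≤ |A|². When A
is bounded, the size hypothesis in (ii) bounds p. -/

/-! ### Sparse polynomials and vanishing orders in characteristic p. -/

section Stepanov

open Polynomial

variable {K : Type*} [Field K]

/-- A polynomial of degree less than the characteristic with at most `k` monomials does not vanish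
to order `k` at `1`. -/
theorem eq_zero_of_X_sub_one_pow_dvd (p : ℕ) [CharP K p] (k : ℕ) :
    ∀ f : K[X], f.support.card ≤ k → (∀ i ∈ f.support, i < p) → (X - 1) ^ k ∣ f → f = 0 := by
  induction k with
  | zero =>
    intro f hf _ _
    simpa using hf
  | succ k ih =>
    intro f hf hdeg hdvd
    by_contra hne
    obtain ⟨e, he⟩ := Polynomial.nonempty_support_iff.mpr hne
    -- The operator X·d/dX − e kills the monomial X^e, so the number of monomials and the order of
    -- vanishing both drop by one. If the result is 0, then f is a multiple of X^e, because
    -- exponents below p are distinct in K; such an f does not vanish at 1.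
    have hcoeff : ∀ i : ℕ, (X * derivative f - C (e : K) * f).coeff i = ((i : K) - e) * f.coeff i := by
      intro i
      cases i with
      | zero => simp
      | succ i => simp [coeff_X_mul, coeff_derivative]; ring
    have hsupp : (X * derivative f - C (e : K) * f).support ⊆ f.support.erase e := by
      intro i hi
      rw [mem_support_iff, hcoeff] at hi
      rw [Finset.mem_erase, mem_support_iff]
      refine ⟨?_, right_ne_zero_of_mul hi⟩
      rintro rfl
      simp at hi
    have hg : X * derivative f - C (e : K) * f = 0 := by
      apply ih
      · have := Finset.card_le_card hsupp
        rw [Finset.card_erase_of_mem he] at this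
        omega
      · exact fun i hi => hdeg i (Finset.mem_of_mem_erase (hsupp hi))
      · apply dvd_sub
        · have h := pow_sub_one_dvd_derivative_of_pow_dvd hdvd
          exact Dvd.dvd.mul_left (by simpa using h) _
        · exact Dvd.dvd.mul_left ((pow_dvd_pow _ (Nat.le_succ k)).trans hdvd) _
    have hmon : f = C (f.coeff e) * X ^ e := by
      ext i
      rw [coeff_C_mul, coeff_X_pow]
      split_ifs with h
      · simp [h]
      · rw [mul_zero]
        by_contra hi
        have h0 := hcoeff i
        rw [hg, coeff_zero] at h0
        have h1 : (i : K) = e := by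
          rcases mul_eq_zero.mp h0.symm with h | h
          · exact sub_eq_zero.mp h
          · exact absurd h hi
        have h2 := (CharP.natCast_eq_natCast K p).mp h1
        exact h (Nat.ModEq.eq_of_lt_of_lt h2 (hdeg i (mem_support_iff.mpr hi)) (hdeg e he))
    have h1 : (X - 1 : K[X]) ∣ f := (dvd_pow_self _ (Nat.succ_ne_zero k)).trans hdvd
    have h2 : f.eval 1 = 0 := by
      obtain ⟨g, rfl⟩ := h1
      simp
    rw [hmon] at h2
    simp only [eval_mul, eval_C, eval_pow, eval_X, one_pow, mul_one] at h2
    exact (mem_support_iff.mp he) h2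

/-- If no nonzero `g i` is divisible by `q`, the `g i` are digits in base `q`. -/
theorem eq_zero_of_sum_mul_pow_eq_zero {R : Type*} [CommRing R] [IsDomain R] {q : R} (hq : q ≠ 0) :
    ∀ (n : ℕ) (g : Fin n → R), ∑ i, g i * q ^ (i : ℕ) = 0 → (∀ i, q ∣ g i → g i = 0) →
      ∀ i, g i = 0 := by
  intro n
  induction n with
  | zero => exact fun _ _ _ i => i.elim0
  | succ n ih =>
    intro g hsum hg
    rw [Fin.sum_univ_succ] at hsum
    have h1 : ∑ i : Fin n, g i.succ * q ^ ((i.succ : Fin (n + 1)) : ℕ) =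
        q * ∑ i : Fin n, g i.succ * q ^ (i : ℕ) := by
      rw [Finset.mul_sum]
      refine Finset.sum_congr rfl fun i _ => ?_
      rw [Fin.val_succ, pow_succ]
      ring
    rw [h1] at hsum
    have h0 : g 0 = 0 := by
      apply hg
      refine ⟨-∑ i : Fin n, g i.succ * q ^ (i : ℕ), ?_⟩
      simp only [Fin.val_zero, pow_zero, mul_one] at hsum
      linear_combination hsum
    rw [h0, zero_mul, zero_add] at hsum
    have h2 := ih (fun i => g i.succ) ((mul_eq_zero.mp hsum).resolve_left hq) fun i => hg _
    intro i
    exact Fin.cases h0 h2 i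

/-- The derivation `X (X - 1) d/dX`. -/
noncomputable def unitDeriv (f : K[X]) : K[X] := X * (X - 1) * derivative f

/-- X(X − 1) is invertible at x, so the hypothesis shifted by one makes F' vanish to order D there.
A root of F of multiplicity m + 1 ≤ D < p would give F' multiplicity exactly m < D. -/
theorem X_sub_C_pow_dvd_of_iterate_unitDeriv (p : ℕ) [CharP K p] {x : K} (hx0 : x ≠ 0)
    (hx1 : x ≠ 1) (D : ℕ) : D ≤ p → ∀ F : K[X], (∀ n < D, (unitDeriv^[n] F).eval x = 0) →
      (X - C x) ^ D ∣ F := by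
  induction D with
  | zero => intro _ F _; simp
  | succ D ih =>
    intro hD F hF
    by_cases hF0 : F = 0
    · simp [hF0]
    have h1 : (X - C x) ^ D ∣ unitDeriv F := by
      apply ih (by omega)
      intro n hn
      have := hF (n + 1) (by omega)
      rwa [Function.iterate_succ_apply] at this
    have h2 : (X - C x) ^ D ∣ derivative F := by
      refine IsCoprime.dvd_of_dvd_mul_left ?_ h1
      apply IsCoprime.pow_left
      refine (Polynomial.irreducible_X_sub_C x).coprime_iff_not_dvd.mpr ?_
      rw [dvd_iff_isRoot]
      simp [hx0, sub_eq_zero, hx1]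
    have hroot : F.IsRoot x := hF 0 (by omega)
    rw [← le_rootMultiplicity_iff hF0]
    by_contra hlt
    have hm : 0 < F.rootMultiplicity x := (rootMultiplicity_pos hF0).mpr hroot
    obtain ⟨G, hG, hGx⟩ := exists_eq_pow_rootMultiplicity_mul_and_not_dvd F hF0 x
    obtain ⟨m, hmeq⟩ : ∃ m, F.rootMultiplicity x = m + 1 := ⟨_, (Nat.succ_pred_eq_of_pos hm).symm⟩
    rw [hmeq] at hG hlt
    have hcast : ((m + 1 : ℕ) : K) ≠ 0 := by
      rw [Ne, CharP.cast_eq_zero_iff K p]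
      exact fun h => absurd (Nat.le_of_dvd (Nat.succ_pos m) h) (by omega)
    have hd : derivative F =
        (X - C x) ^ m * (C ((m + 1 : ℕ) : K) * G + (X - C x) * derivative G) := by
      rw [hG, derivative_mul, derivative_X_sub_C_pow]
      simp only [Nat.add_sub_cancel]
      ring
    have h3 : (X - C x) ^ (m + 1) ∣ derivative F := (pow_dvd_pow _ (by omega)).trans h2
    rw [hd, pow_succ] at h3
    have h4 := (mul_dvd_mul_iff_left (pow_ne_zero m (X_sub_C_ne_zero x))).mp h3
    rw [dvd_iff_isRoot] at h4 hGx
    simp only [IsRoot.def, eval_add, eval_mul, eval_C, eval_sub, eval_X, sub_self, zero_mul,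
      add_zero, mul_eq_zero] at h4
    exact h4.elim hcast hGx

/-- The operator induced on the coefficient of `X ^ (t * b) * (X - 1) ^ (t * c)` by
`X (X - 1) d/dX`. -/
noncomputable def twistedDeriv (t b c : ℕ) : K[X] →ₗ[K] K[X] where
  toFun f := X * (X - 1) * derivative f + (C ((t * b : ℕ) : K) * (X - 1) +
    C ((t * c : ℕ) : K) * X) * f
  map_add' f g := by simp only [derivative_add]; ring
  map_smul' r f := by
    simp only [derivative_smul, RingHom.id_apply, smul_add, mul_smul_comm]

theorem twistedDeriv_apply (t b c : ℕ) (f : K[X]) : twistedDeriv t b c f =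
    X * (X - 1) * derivative f + (C ((t * b : ℕ) : K) * (X - 1) + C ((t * c : ℕ) : K) * X) * f :=
  rfl

theorem X_mul_derivative_X_pow (n : ℕ) : X * derivative (X ^ n : K[X]) = C (n : K) * X ^ n := by
  cases n with
  | zero => simp
  | succ n => rw [derivative_X_pow, Nat.add_sub_cancel]; ring

theorem X_sub_one_mul_derivative_pow (n : ℕ) :
    (X - 1) * derivative ((X - 1) ^ n : K[X]) = C (n : K) * (X - 1) ^ n := by
  cases n with
  | zero => simp
  | succ n =>
    rw [← C_1, derivative_X_sub_C_pow, Nat.add_sub_cancel]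
    ring

/-- The factor X^{tb}(X − 1)^{tc} survives differentiation. At a point with prescribed x^t and (x −
1)^t it is a known constant, so the vanishing conditions involve only low-degree polynomials. -/
theorem unitDeriv_mul (t b c : ℕ) (f : K[X]) :
    unitDeriv (f * (X ^ (t * b) * (X - 1) ^ (t * c))) =
      twistedDeriv t b c f * (X ^ (t * b) * (X - 1) ^ (t * c)) := by
  rw [unitDeriv, twistedDeriv_apply, derivative_mul, derivative_mul]
  linear_combination f * (X - 1) * (X - 1) ^ (t * c) * X_mul_derivative_X_pow (K := K) (t * b) +
    f * X * X ^ (t * b) * X_sub_one_mul_derivative_pow (K := K) (t * c)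

theorem unitDeriv_sum {ι : Type*} (s : Finset ι) (f : ι → K[X]) :
    unitDeriv (∑ i ∈ s, f i) = ∑ i ∈ s, unitDeriv (f i) := by
  simp only [unitDeriv, derivative_sum, Finset.mul_sum]

theorem iterate_unitDeriv_sum {ι : Type*} (s : Finset ι) (t : ℕ) (b c : ι → ℕ) (n : ℕ) :
    ∀ v : ι → K[X], unitDeriv^[n] (∑ i ∈ s, v i * (X ^ (t * b i) * (X - 1) ^ (t * c i))) =
      ∑ i ∈ s, (twistedDeriv t (b i) (c i) ^ n) (v i) *
        (X ^ (t * b i) * (X - 1) ^ (t * c i)) := by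
  induction n with
  | zero => intro v; simp
  | succ n ih =>
    intro v
    rw [Function.iterate_succ_apply, unitDeriv_sum]
    simp only [unitDeriv_mul]
    rw [ih]
    rfl

theorem twistedDeriv_pow_mem_degreeLT (t b c : ℕ) {A : ℕ} {f : K[X]} (hf : f ∈ degreeLT K A)
    (n : ℕ) : (twistedDeriv t b c ^ n) f ∈ degreeLT K (A + n) := by
  induction n with
  | zero => simpa using hf
  | succ n ih =>
    rw [pow_succ', Module.End.mul_apply]
    set g := (twistedDeriv t b c ^ n) f
    rw [mem_degreeLT, twistedDeriv_apply]
    by_cases hg : g = 0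
    · simp [hg]
    rw [mem_degreeLT, degree_eq_natDegree hg, Nat.cast_lt] at ih
    refine lt_of_le_of_lt (b := ((g.natDegree + 1 : ℕ) : WithBot ℕ)) ?_ (by
      rw [Nat.cast_lt]; omega)
    have hX1 : (X - 1 : K[X]).degree ≤ 1 := by
      rw [← C_1]; exact (degree_X_sub_C _).le
    refine (degree_add_le _ _).trans (max_le ?_ ?_)
    · by_cases hd : derivative g = 0
      · simp [hd]
      have h1 : (derivative g).degree < g.degree := degree_derivative_lt hg
      rw [degree_eq_natDegree hg, degree_eq_natDegree hd, Nat.cast_lt] at h1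
      refine (degree_mul_le _ _).trans ?_
      rw [degree_eq_natDegree hd]
      calc (X * (X - 1) : K[X]).degree + ((derivative g).natDegree : WithBot ℕ)
          ≤ (1 + 1) + ((derivative g).natDegree : WithBot ℕ) := by
            gcongr
            exact (degree_mul_le _ _).trans (add_le_add degree_X_le hX1)
        _ = ((1 + 1 + (derivative g).natDegree : ℕ) : WithBot ℕ) := by push_cast; rfl
        _ ≤ _ := by rw [Nat.cast_le]; omega
    · refine (degree_mul_le _ _).trans ?_
      rw [degree_eq_natDegree hg]
      calc _ ≤ (1 : WithBot ℕ) + (g.natDegree : WithBot ℕ) := by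
            gcongr
            refine (degree_add_le _ _).trans (max_le ?_ ?_)
            · refine (degree_mul_le _ _).trans ?_
              calc _ ≤ (0 : WithBot ℕ) + 1 := add_le_add degree_C_le hX1
                _ = 1 := zero_add 1
            · refine (degree_mul_le _ _).trans ?_
              calc _ ≤ (0 : WithBot ℕ) + 1 := add_le_add degree_C_le degree_X_le
                _ = 1 := zero_add 1
        _ = ((1 + g.natDegree : ℕ) : WithBot ℕ) := by push_cast; rfl
        _ ≤ _ := by rw [Nat.cast_le]; omega

end Stepanov

/-! ### Stepanov's method. -/

section StepanovBound

open Polynomial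

variable {K : Type*} [Field K]

theorem X_pow_sum_eq_zero {A B t : ℕ} (hAt : A ≤ t) (v : Fin B → K[X])
    (hv : ∀ b, v b ∈ degreeLT K A) (hsum : ∑ b, v b * X ^ (t * (b : ℕ)) = 0) :
    ∀ b, v b = 0 := by
  refine eq_zero_of_sum_mul_pow_eq_zero (q := (X ^ t : K[X])) (pow_ne_zero _ X_ne_zero) B v ?_ ?_
  · simpa only [pow_mul] using hsum
  · intro b hb
    by_contra h0
    have h1 := degree_le_of_dvd hb h0
    rw [degree_X_pow] at h1
    have h2 := mem_degreeLT.mp (hv b)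
    exact absurd (h1.trans_lt h2) (by rw [Nat.cast_lt]; omega)

theorem support_sum_mul_X_pow_subset {A B t : ℕ} (v : Fin B → K[X])
    (hv : ∀ b, v b ∈ degreeLT K A) :
    (∑ b, v b * X ^ (t * (b : ℕ))).support ⊆
      (Finset.univ : Finset (Fin A × Fin B)).image fun x => (x.1 : ℕ) + t * (x.2 : ℕ) := by
  intro i hi
  rw [mem_support_iff, finsetSum_coeff] at hi
  obtain ⟨b, -, hb⟩ := Finset.exists_ne_zero_of_sum_ne_zero hi
  rw [coeff_mul_X_pow'] at hb
  split_ifs at hb with h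
  · have h1 : i - t * (b : ℕ) < A := by
      by_contra hlt
      refine hb (coeff_eq_zero_of_degree_lt ((mem_degreeLT.mp (hv b)).trans_le ?_))
      rw [Nat.cast_le]; omega
    rw [Finset.mem_image]
    exact ⟨(⟨_, h1⟩, b), Finset.mem_univ _, by simp only; omega⟩
  · exact absurd rfl hb

/-- This makes the auxiliary polynomial nonzero. It is expanded in base (X − 1)^t: each digit has at
most AB ≤ t monomials, of degree below tB ≤ p, so it is divisible by (X − 1)^t only if it is 0. The
digits are then expanded in base X^t. -/
theorem X_pow_X_sub_one_pow_sum_eq_zero (p : ℕ) [CharP K p] {A B E t : ℕ} (hAt : A ≤ t)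
    (hAB : A * B ≤ t) (hp : t * B ≤ p) (v : Fin B × Fin E → K[X])
    (hv : ∀ i, v i ∈ degreeLT K A)
    (hsum : ∑ i, v i * (X ^ (t * (i.1 : ℕ)) * (X - 1) ^ (t * (i.2 : ℕ))) = 0) :
    ∀ i, v i = 0 := by
  have hX1 : (X - 1 : K[X]) ≠ 0 := by
    rw [← C_1]; exact X_sub_C_ne_zero 1
  have h := eq_zero_of_sum_mul_pow_eq_zero (q := ((X - 1) ^ t : K[X])) (pow_ne_zero _ hX1) E
    (fun c => ∑ b, v (b, c) * X ^ (t * (b : ℕ))) ?_ ?_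
  · rintro ⟨b, c⟩
    exact X_pow_sum_eq_zero hAt (fun b => v (b, c)) (fun b => hv _) (h c) b
  · rw [← hsum, Fintype.sum_prod_type_right]
    refine Finset.sum_congr rfl fun c _ => ?_
    rw [Finset.sum_mul]
    refine Finset.sum_congr rfl fun b _ => ?_
    rw [← pow_mul]
    ring
  · intro c hc
    have hs := support_sum_mul_X_pow_subset (t := t) (fun b => v (b, c)) fun b => hv _
    refine eq_zero_of_X_sub_one_pow_dvd p t _ ?_ ?_ hc
    · refine (Finset.card_le_card hs).trans (Finset.card_image_le.trans ?_)
      simpa using hAB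
    · intro i hi
      obtain ⟨x, -, rfl⟩ := Finset.mem_image.mp (hs hi)
      have h1 := x.1.2
      have h2 := x.2.2
      calc (x.1 : ℕ) + t * (x.2 : ℕ) < t + t * (x.2 : ℕ) := by omega
        _ = t * ((x.2 : ℕ) + 1) := by ring
        _ ≤ t * B := Nat.mul_le_mul_left t h2
        _ ≤ p := hp

/-- The auxiliary polynomials: there are coefficients, not all zero, for which every `unitDeriv`
iterate up to order `D` vanishes at all points with `(x ^ t, (x - 1) ^ t) ∈ J`. -/
theorem exists_auxiliary_coefficients (t : ℕ) {A B E D : ℕ} (J : Finset (K × K))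
    (hcount : J.card * D * (A + D) < A * (B * E)) :
    ∃ v : Fin B × Fin E → K[X], (∀ i, v i ∈ degreeLT K A) ∧ (∃ i, v i ≠ 0) ∧
      ∀ j ∈ J, ∀ n < D,
        ∑ i, C (j.1 ^ (i.1 : ℕ) * j.2 ^ (i.2 : ℕ)) * (twistedDeriv t i.1 i.2 ^ n) (v i) = 0 := by
  classical
  let Φ : (J × Fin D) → ((Fin B × Fin E → degreeLT K A) →ₗ[K] K[X]) := fun q =>
    ∑ i, (q.1.1.1 ^ (i.1 : ℕ) * q.1.1.2 ^ (i.2 : ℕ)) •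
      ((twistedDeriv t i.1 i.2 ^ (q.2 : ℕ)) ∘ₗ (degreeLT K A).subtype ∘ₗ LinearMap.proj i)
  let Ψ : (Fin B × Fin E → degreeLT K A) →ₗ[K] ((J × Fin D) × Fin (A + D) → K) :=
    LinearMap.pi fun q => lcoeff K (q.2 : ℕ) ∘ₗ Φ q.1
  have hfin : Module.finrank K (degreeLT K A) = A := by
    rw [LinearEquiv.finrank_eq (degreeLTEquiv K A), Module.finrank_fin_fun]
  have : Module.Finite K (degreeLT K A) := Module.Finite.equiv (degreeLTEquiv K A).symm
  -- There are A·B·E unknown coefficients and |J|·D·(A + D) linear equations.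
  have hker : LinearMap.ker Ψ ≠ ⊥ := by
    apply LinearMap.ker_ne_bot_of_finrank_lt
    rw [Module.finrank_fintype_fun_eq_card, Module.finrank_pi_fintype]
    simp only [hfin, Finset.sum_const, Finset.card_univ, Fintype.card_prod, Fintype.card_fin,
      Fintype.card_coe, smul_eq_mul]
    linarith
  obtain ⟨w, hw, hw0⟩ := Submodule.exists_mem_ne_zero_of_ne_bot hker
  refine ⟨fun i => w i, fun i => (w i).2, ?_, ?_⟩
  · by_contra! h
    exact hw0 (funext fun i => Subtype.ext (h i))
  · intro j hj n hn
    have hΦ : Φ (⟨j, hj⟩, ⟨n, hn⟩) w = ∑ i, C (j.1 ^ (i.1 : ℕ) * j.2 ^ (i.2 : ℕ)) *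
        (twistedDeriv t i.1 i.2 ^ n) (w i : K[X]) := by
      simp only [Φ, LinearMap.sum_apply, LinearMap.smul_apply, LinearMap.comp_apply,
        LinearMap.proj_apply, Submodule.subtype_apply, smul_eq_C_mul]
    rw [← hΦ]
    have hmem : Φ (⟨j, hj⟩, ⟨n, hn⟩) w ∈ degreeLT K (A + D) := by
      rw [hΦ]
      refine Submodule.sum_mem _ fun i _ => ?_
      rw [← smul_eq_C_mul]
      refine Submodule.smul_mem _ _ ?_
      exact degreeLT_mono (by omega) (twistedDeriv_pow_mem_degreeLT t i.1 i.2 (w i).2 n)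
    ext k
    rw [coeff_zero]
    by_cases hk : k < A + D
    · exact congrFun (LinearMap.mem_ker.mp hw) ((⟨j, hj⟩, ⟨n, hn⟩), ⟨k, hk⟩)
    · refine coeff_eq_zero_of_degree_lt ((mem_degreeLT.mp hmem).trans_le ?_)
      rw [Nat.cast_le]; omega

/-- The auxiliary polynomial is nonzero and vanishes to order D at every point of S, so |S|·D is at
most its degree. -/
theorem stepanov_card_le (p : ℕ) [CharP K p] {t A B E D : ℕ} (hAt : A ≤ t) (hAB : A * B ≤ t)
    (hp : t * B ≤ p) (hDp : D ≤ p) (J : Finset (K × K))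
    (hcount : J.card * D * (A + D) < A * (B * E)) (S : Finset K)
    (hS : ∀ x ∈ S, x ≠ 0 ∧ x ≠ 1 ∧ (x ^ t, (x - 1) ^ t) ∈ J) :
    S.card * D ≤ A + t * (B + E) := by
  obtain ⟨v, hv, ⟨i₀, hi₀⟩, hvan⟩ := exists_auxiliary_coefficients t J hcount
  set F : K[X] := ∑ i, v i * (X ^ (t * (i.1 : ℕ)) * (X - 1) ^ (t * (i.2 : ℕ))) with hF
  have hF0 : F ≠ 0 := fun h =>
    hi₀ (X_pow_X_sub_one_pow_sum_eq_zero p hAt hAB hp v hv h i₀)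
  have hdvd : ∀ x ∈ S, (X - C x) ^ D ∣ F := by
    intro x hx
    obtain ⟨hx0, hx1, hxJ⟩ := hS x hx
    refine X_sub_C_pow_dvd_of_iterate_unitDeriv p hx0 hx1 D hDp F fun n hn => ?_
    rw [hF, iterate_unitDeriv_sum, eval_finsetSum]
    have h := congrArg (eval x) (hvan _ hxJ n hn)
    rw [eval_finsetSum, eval_zero] at h
    rw [← h]
    refine Finset.sum_congr rfl fun i _ => ?_
    simp only [eval_mul, eval_pow, eval_X, eval_sub, eval_one, eval_C, pow_mul]
    ring
  have hprod : ∏ x ∈ S, (X - C x) ^ D ∣ F := by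
    refine Finset.prod_dvd_of_coprime ?_ hdvd
    intro x _ y _ hxy
    exact (isCoprime_X_sub_C_of_isUnit_sub (sub_ne_zero.mpr hxy).isUnit).pow
  have hdeg := natDegree_le_of_dvd hprod hF0
  have hdl : (∏ x ∈ S, (X - C x) ^ D).natDegree = S.card * D := by
    rw [natDegree_prod_of_monic _ _ fun x _ => (monic_X_sub_C x).pow D]
    simp
  rw [hdl] at hdeg
  refine hdeg.trans (natDegree_sum_le_of_forall_le _ _ fun i _ => ?_)
  have h1 : (v i).natDegree ≤ A := natDegree_le_of_degree_le (mem_degreeLT.mp (hv i)).le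
  have h2 : ((X - 1 : K[X]) ^ (t * (i.2 : ℕ))).natDegree = t * (i.2 : ℕ) := by
    rw [← C_1, natDegree_pow, natDegree_X_sub_C, mul_one]
  calc _ ≤ (v i).natDegree + ((X ^ (t * (i.1 : ℕ)) : K[X]).natDegree +
        ((X - 1 : K[X]) ^ (t * (i.2 : ℕ))).natDegree) :=
        natDegree_mul_le.trans (Nat.add_le_add_left natDegree_mul_le _)
    _ ≤ A + (t * B + t * E) := by
        rw [h2, natDegree_X_pow]
        gcongr
        · exact i.1.2.le
        · exact i.2.2.le
    _ = _ := by ring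

/-- The Stepanov bound with the number of monomials chosen optimally. -/
theorem stepanov_card_le_sq (p : ℕ) [CharP K p] {t B : ℕ} (J : Finset (K × K))
    (hB : J.card * t < B ^ 3) (hBt : B ≤ t) (hp : t * B ≤ p) (S : Finset K)
    (hS : ∀ x ∈ S, x ≠ 0 ∧ x ≠ 1 ∧ (x ^ t, (x - 1) ^ t) ∈ J) : S.card ≤ 7 * B ^ 2 := by
  have hB0 : 0 < B := by
    rcases Nat.eq_zero_or_pos B with h | h
    · simp [h] at hB
    · exact h
  -- D also serves as the degree bound A, and E = 2B. The counting condition becomes |J|·D < B², and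
  -- AB ≤ t holds because DB ≤ t.
  set D := t / B with hD
  have hDB : D * B ≤ t := Nat.div_mul_le_self t B
  have hD0 : 0 < D := Nat.div_pos hBt hB0
  have hDt : D ≤ t := Nat.div_le_self t B
  have htD : t ≤ 2 * (D * B) := by
    have h1 : t < D * B + B := by
      have := Nat.lt_div_mul_add hB0 (a := t)
      simpa [hD] using this
    nlinarith
  have hnD : J.card * D < B ^ 2 := by
    have h1 : J.card * D * B < B ^ 2 * B := by
      calc J.card * D * B = J.card * (D * B) := by ring
        _ ≤ J.card * t := Nat.mul_le_mul_left _ hDB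
        _ < B ^ 2 * B := by rw [← pow_succ]; exact hB
    exact lt_of_mul_lt_mul_right h1 (Nat.zero_le B)
  have h := stepanov_card_le p (A := D) (B := B) (E := 2 * B) (D := D) hDt hDB hp
    ((hDt.trans (Nat.le_mul_of_pos_right t hB0)).trans hp) J (by nlinarith) S hS
  have h2 : S.card * D ≤ 7 * B ^ 2 * D := by
    calc S.card * D ≤ D + t * (B + 2 * B) := h
      _ ≤ D + 2 * (D * B) * (B + 2 * B) := by gcongr
      _ = D * (1 + 6 * B ^ 2) := by ring
      _ ≤ D * (B ^ 2 + 6 * B ^ 2) := by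
          gcongr
          exact Nat.one_le_pow _ _ hB0
      _ = _ := by ring
  exact Nat.le_of_mul_le_mul_right h2 hD0

theorem exists_least_cube_gt {n : ℕ} (hn : 0 < n) :
    ∃ B : ℕ, n < B ^ 3 ∧ B ^ 3 ≤ 8 * n ∧ ∀ B', n < B' ^ 3 → B ≤ B' := by
  have hex : ∃ B : ℕ, n < B ^ 3 := ⟨n + 1, by nlinarith [Nat.zero_le (n ^ 2), Nat.zero_le (n ^ 3)]⟩
  classical
  refine ⟨Nat.find hex, Nat.find_spec hex, ?_, fun B' h => Nat.find_min' hex h⟩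
  have hspec := Nat.find_spec hex
  obtain ⟨b, hb⟩ : ∃ b, Nat.find hex = b + 1 := by
    refine ⟨Nat.find hex - 1, ?_⟩
    have : Nat.find hex ≠ 0 := fun h => by rw [h] at hspec; simp at hspec
    omega
  have hmin : b ^ 3 ≤ n := not_lt.mp (Nat.find_min hex (by omega))
  rw [hb]
  rcases Nat.eq_zero_or_pos b with h | h
  · subst h; omega
  · calc (b + 1) ^ 3 ≤ (2 * b) ^ 3 := Nat.pow_le_pow_left (by omega) 3
      _ = 8 * b ^ 3 := by ring
      _ ≤ 8 * n := by omega

theorem card_cube_le_of_le_sq {s B n : ℕ} (hs : s ≤ 7 * B ^ 2) (hB : B ^ 3 ≤ 8 * n) :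
    s ^ 3 ≤ 21952 * n ^ 2 := by
  calc s ^ 3 ≤ (7 * B ^ 2) ^ 3 := Nat.pow_le_pow_left hs 3
    _ = 343 * (B ^ 3) ^ 2 := by ring
    _ ≤ 343 * (8 * n) ^ 2 := by gcongr
    _ = 21952 * n ^ 2 := by ring

end StepanovBound

/-! ### Multiplicative energy of a shifted group. -/

section ShiftedEnergy

variable {K : Type*} [Field K] [DecidableEq K]

/-- The number of ways to write `ρ` as a quotient `(u - 1) / (v - 1)` with `u, v ∈ G`. -/
def shiftRep (G : Finset K) (ρ : K) : ℕ :=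
  ((G.erase 1 ×ˢ G.erase 1).filter fun x => x.1 - 1 = ρ * (x.2 - 1)).card

theorem sum_shiftRep_le (G : Finset K) (Q : Finset K) :
    ∑ ρ ∈ Q, shiftRep G ρ ≤ (G.erase 1).card ^ 2 := by
  unfold shiftRep
  rw [sq, ← Finset.card_product, ← Finset.card_biUnion]
  · refine Finset.card_le_card ?_
    intro x hx
    obtain ⟨ρ, -, hx⟩ := Finset.mem_biUnion.mp hx
    exact (Finset.mem_filter.mp hx).1
  · intro ρ _ σ _ hρσ
    rw [Function.onFun, Finset.disjoint_left]
    intro x hx hx'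
    rw [Finset.mem_filter, Finset.mem_product] at hx hx'
    have h1 : x.2 - 1 ≠ 0 := sub_ne_zero.mpr (Finset.ne_of_mem_erase hx.1.2)
    exact hρσ (mul_right_cancel₀ h1 (hx.2.symm.trans hx'.2))

variable [Fintype K]

/-- The fibres of `x ↦ (x ^ t, (x - 1) ^ t)` on `K ∖ {0, 1}`. -/
def powerFiber (t : ℕ) (j : K × K) : Finset K :=
  Finset.univ.filter fun x => x ≠ 0 ∧ x ≠ 1 ∧ (x ^ t, (x - 1) ^ t) = j

theorem mem_powerFiber {t : ℕ} {j : K × K} {x : K} :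
    x ∈ powerFiber t j ↔ x ≠ 0 ∧ x ≠ 1 ∧ (x ^ t, (x - 1) ^ t) = j := by
  simp [powerFiber]

theorem card_powerFiber_le {t : ℕ} (ht : 0 < t) (j : K × K) : (powerFiber t j).card ≤ t := by
  have hsub : powerFiber t j ⊆ (Polynomial.nthRoots t j.1).toFinset := by
    intro x hx
    rw [Multiset.mem_toFinset, Polynomial.mem_nthRoots ht]
    exact congrArg Prod.fst (mem_powerFiber.mp hx).2.2
  exact (Finset.card_le_card hsub).trans
    ((Multiset.toFinset_card_le _).trans (Polynomial.card_nthRoots t j.1))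

/-- A pair with u − 1 = ρ(v − 1) goes to x = ρv/u, for which x − 1 = (ρ − 1)/u. Taking t-th powers
removes u and v, while x − 1 determines u and then v. -/
theorem shiftRep_le_card_powerFiber {G : Finset K} {t : ℕ} (h0 : ∀ u ∈ G, u ≠ 0)
    (ht : ∀ u ∈ G, u ^ t = 1) {ρ : K} (hρ0 : ρ ≠ 0) (hρ1 : ρ ≠ 1) :
    shiftRep G ρ ≤ (powerFiber t (ρ ^ t, (ρ - 1) ^ t)).card := by
  have key : ∀ x ∈ (G.erase 1 ×ˢ G.erase 1).filter fun x => x.1 - 1 = ρ * (x.2 - 1),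
      x.1 ∈ G ∧ x.2 ∈ G ∧ x.1 ≠ 0 ∧ x.1 - 1 = ρ * (x.2 - 1) ∧
        ρ * x.2 / x.1 - 1 = (ρ - 1) / x.1 := by
    intro x hx
    rw [Finset.mem_filter, Finset.mem_product, Finset.mem_erase, Finset.mem_erase] at hx
    obtain ⟨⟨⟨-, h1⟩, -, h2⟩, h3⟩ := hx
    refine ⟨h1, h2, h0 _ h1, h3, ?_⟩
    have := h0 _ h1
    field_simp
    linear_combination -h3
  refine Finset.card_le_card_of_injOn (fun x => ρ * x.2 / x.1) ?_ ?_
  · intro x hx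
    obtain ⟨h1, h2, h3, h4, h5⟩ := key x hx
    rw [Finset.mem_coe, mem_powerFiber]
    refine ⟨div_ne_zero (mul_ne_zero hρ0 (h0 _ h2)) h3, ?_, ?_⟩
    · rw [← sub_ne_zero, h5]
      exact div_ne_zero (sub_ne_zero.mpr hρ1) h3
    · simp only
      rw [h5, div_pow, div_pow, mul_pow, ht _ h1, ht _ h2, mul_one, div_one, div_one]
  · intro x hx y hy hxy
    obtain ⟨-, -, hx3, hx4, hx5⟩ := key x hx
    obtain ⟨-, -, hy3, hy4, hy5⟩ := key y hy
    simp only at hxy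
    have h1 : x.1 = y.1 := by
      rw [hxy, hy5, div_eq_div_iff hy3 hx3] at hx5
      exact mul_left_cancel₀ (sub_ne_zero.mpr hρ1) hx5
    have h2 : x.2 = y.2 := by
      rw [h1, hy4] at hx4
      have := mul_left_cancel₀ hρ0 hx4
      linear_combination -this
    exact Prod.ext h1 h2

/-- Stepanov's bound is applied to the union of the disjoint fibres over J, which has at least τ|J|
points. The condition |J| < t² keeps B ≤ t. -/
theorem cube_mul_card_le_of_le_card_powerFiber (p : ℕ) [CharP K p] {t : ℕ} (ht : 0 < t)
    (hp : t * t ≤ p) (J : Finset (K × K)) (hJ : J.card < t ^ 2) (τ : ℕ)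
    (hτ : ∀ j ∈ J, τ ≤ (powerFiber t j).card) : τ ^ 3 * J.card ≤ 21952 * t ^ 2 := by
  rcases Nat.eq_zero_or_pos J.card with h0 | h0
  · simp [h0]
  obtain ⟨B, hB1, hB2, hB3⟩ := exists_least_cube_gt (Nat.mul_pos h0 ht)
  have hBt : B ≤ t := hB3 t (by rw [pow_succ]; exact Nat.mul_lt_mul_of_pos_right hJ ht)
  have hS := stepanov_card_le_sq p J hB1 hBt ((Nat.mul_le_mul_left t hBt).trans hp)
    (J.biUnion (powerFiber t)) (by
      intro x hx
      obtain ⟨j, hj, hx⟩ := Finset.mem_biUnion.mp hx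
      obtain ⟨h1, h2, h3⟩ := mem_powerFiber.mp hx
      exact ⟨h1, h2, h3 ▸ hj⟩)
  have hcard : J.card * τ ≤ (J.biUnion (powerFiber t)).card := by
    rw [Finset.card_biUnion]
    · rw [← smul_eq_mul]
      exact Finset.card_nsmul_le_sum _ _ _ hτ
    · intro i _ j _ hij
      rw [Function.onFun, Finset.disjoint_left]
      intro x hx hx'
      exact hij ((mem_powerFiber.mp hx).2.2.symm.trans (mem_powerFiber.mp hx').2.2)
  have h := (Nat.pow_le_pow_left hcard 3).trans (card_cube_le_of_le_sq hS hB2)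
  have h' : (J.card ^ 2) * (τ ^ 3 * J.card) ≤ (J.card ^ 2) * (21952 * t ^ 2) := by
    calc _ = (J.card * τ) ^ 3 := by ring
      _ ≤ _ := h
      _ = _ := by ring
  exact Nat.le_of_mul_le_mul_left h' (by positivity)

theorem cube_le_sum_sq (n : ℕ) : (n : ℝ) ^ 3 ≤ ∑ τ ∈ Finset.Icc 1 n, 3 * (τ : ℝ) ^ 2 := by
  induction n with
  | zero => simp
  | succ n ih =>
    rw [Finset.sum_Icc_succ_top (by omega)]
    push_cast
    have : (0 : ℝ) ≤ n := Nat.cast_nonneg n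
    nlinarith

/-- Layer-cake summation: the level τ has weight 3τ² and contains O(t²/τ³) fibres, so a harmonic sum
remains. The constant is 3·21952. -/
theorem sum_card_powerFiber_cube_le (p : ℕ) [CharP K p] {t : ℕ} (ht : 0 < t)
    (hp : t * t ≤ p) (J : Finset (K × K)) (hJ : J.card < t ^ 2) :
    ∑ j ∈ J, ((powerFiber t j).card : ℝ) ^ 3 ≤ 65856 * (t : ℝ) ^ 2 * (1 + Real.log t) := by
  have hlevel : ∀ τ ∈ Finset.Icc 1 t, (3 * (τ : ℝ) ^ 2) *
      ((J.filter fun j => τ ≤ (powerFiber t j).card).card : ℝ) ≤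
        65856 * (t : ℝ) ^ 2 * (τ : ℝ)⁻¹ := by
    intro τ hτ
    have h1 : 0 < τ := (Finset.mem_Icc.mp hτ).1
    have h := cube_mul_card_le_of_le_card_powerFiber p ht hp
      (J.filter fun j => τ ≤ (powerFiber t j).card)
      ((Finset.card_filter_le _ _).trans_lt hJ) τ fun j hj => (Finset.mem_filter.mp hj).2
    have h' : (τ : ℝ) ^ 3 * ((J.filter fun j => τ ≤ (powerFiber t j).card).card : ℝ) ≤
        21952 * (t : ℝ) ^ 2 := by exact_mod_cast h
    have h2 : (0 : ℝ) < τ := Nat.cast_pos.mpr h1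
    rw [← div_eq_mul_inv, le_div_iff₀ h2]
    nlinarith
  calc ∑ j ∈ J, ((powerFiber t j).card : ℝ) ^ 3
      ≤ ∑ j ∈ J, ∑ τ ∈ Finset.Icc 1 t, if τ ≤ (powerFiber t j).card then 3 * (τ : ℝ) ^ 2 else 0 := by
        refine Finset.sum_le_sum fun j _ => (cube_le_sum_sq _).trans ?_
        rw [← Finset.sum_filter]
        refine Finset.sum_le_sum_of_subset_of_nonneg ?_ fun τ _ _ => by positivity
        intro τ hτ
        rw [Finset.mem_Icc] at hτ
        rw [Finset.mem_filter, Finset.mem_Icc]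
        exact ⟨⟨hτ.1, hτ.2.trans (card_powerFiber_le ht j)⟩, hτ.2⟩
    _ = ∑ τ ∈ Finset.Icc 1 t, (3 * (τ : ℝ) ^ 2) *
          ((J.filter fun j => τ ≤ (powerFiber t j).card).card : ℝ) := by
        rw [Finset.sum_comm]
        refine Finset.sum_congr rfl fun τ _ => ?_
        rw [← Finset.sum_filter, Finset.sum_const, nsmul_eq_mul, mul_comm]
    _ ≤ ∑ τ ∈ Finset.Icc 1 t, 65856 * (t : ℝ) ^ 2 * (τ : ℝ)⁻¹ := Finset.sum_le_sum hlevel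
    _ = 65856 * (t : ℝ) ^ 2 * (harmonic t : ℝ) := by
        rw [← Finset.mul_sum, harmonic_eq_sum_Icc]
        push_cast
        rfl
    _ ≤ _ := by
        gcongr
        exact harmonic_le_one_add_log t

/-- The multiplicative energy of a shifted group of roots of unity. -/
theorem sum_shiftRep_sq_le (p : ℕ) [CharP K p] {G : Finset K} (h1 : 1 ∈ G)
    (hp : G.card * G.card ≤ p) (h0 : ∀ u ∈ G, u ≠ 0) (ht : ∀ u ∈ G, u ^ G.card = 1)
    (Q : Finset K) (hQ : ∀ ρ ∈ Q, ρ ≠ 0 ∧ ρ ≠ 1) :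
    ∑ ρ ∈ Q, (shiftRep G ρ : ℝ) ^ 2 ≤
      65856 * (G.card : ℝ) ^ 2 * (1 + Real.log G.card) := by
  set t := G.card with htdef
  have htpos : 0 < t := Finset.card_pos.mpr ⟨1, h1⟩
  -- Only ratios that are attained matter; there are at most (t − 1)² of them, which gives |J| < t².
  set P := Q.filter fun ρ => shiftRep G ρ ≠ 0 with hP
  have hPQ : ∀ ρ ∈ P, ρ ≠ 0 ∧ ρ ≠ 1 := fun ρ h => hQ ρ (Finset.mem_filter.mp h).1
  set φ : K → K × K := fun ρ => (ρ ^ t, (ρ - 1) ^ t)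
  have hJ : (P.image φ).card < t ^ 2 := by
    have h2 : P.card ≤ (G.erase 1).card ^ 2 := by
      refine le_trans ?_ (sum_shiftRep_le G P)
      rw [Finset.card_eq_sum_ones]
      exact Finset.sum_le_sum fun ρ h => Nat.one_le_iff_ne_zero.mpr (Finset.mem_filter.mp h).2
    rw [Finset.card_erase_of_mem h1, ← htdef] at h2
    exact (Finset.card_image_le.trans h2).trans_lt (Nat.pow_lt_pow_left (by omega) (by norm_num))
  calc ∑ ρ ∈ Q, (shiftRep G ρ : ℝ) ^ 2 = ∑ ρ ∈ P, (shiftRep G ρ : ℝ) ^ 2 := by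
        symm
        refine Finset.sum_subset (Finset.filter_subset _ _) fun ρ hρ hρ' => ?_
        have : shiftRep G ρ = 0 := by
          by_contra h
          exact hρ' (Finset.mem_filter.mpr ⟨hρ, h⟩)
        simp [this]
    _ ≤ ∑ ρ ∈ P, ((powerFiber t (φ ρ)).card : ℝ) ^ 2 := by
        refine Finset.sum_le_sum fun ρ hρ => ?_
        have := shiftRep_le_card_powerFiber h0 ht (hPQ ρ hρ).1 (hPQ ρ hρ).2
        gcongr
    _ = ∑ j ∈ P.image φ, ∑ ρ ∈ P.filter (fun ρ => φ ρ = j), ((powerFiber t j).card : ℝ) ^ 2 := by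
        rw [← Finset.sum_fiberwise_of_maps_to (g := φ) (t := P.image φ)
          fun ρ h => Finset.mem_image_of_mem φ h]
        refine Finset.sum_congr rfl fun j _ => Finset.sum_congr rfl fun ρ hρ => ?_
        rw [(Finset.mem_filter.mp hρ).2]
    -- Each ρ lies in its own fibre, so at most |fibre| ratios share the value j; this turns squares
    -- into cubes.
    _ ≤ ∑ j ∈ P.image φ, ((powerFiber t j).card : ℝ) ^ 3 := by
        refine Finset.sum_le_sum fun j _ => ?_
        rw [Finset.sum_const, nsmul_eq_mul, pow_succ' _ 2]
        gcongr
        intro ρ hρ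
        obtain ⟨h2, h3⟩ := Finset.mem_filter.mp hρ
        exact mem_powerFiber.mpr ⟨(hPQ ρ h2).1, (hPQ ρ h2).2, h3⟩
    _ ≤ _ := sum_card_powerFiber_cube_le p htpos hp _ hJ

end ShiftedEnergy

/-! ### Solutions of x + y = 1 in a multiplicative group. -/

section UnitSums

variable {K : Type*} [Field K] [DecidableEq K]

/-- All solutions lie in the single fibre x^t = 1, (x − 1)^t = (−1)^t, so Stepanov applies with |J|
= 1. The bound 8t^4 ≤ p³ ensures tB ≤ p. -/
theorem card_unit_sums_cube_le (p : ℕ) [CharP K p] {G : Finset K}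
    (hp : 8 * G.card ^ 4 ≤ p ^ 3) (h0 : ∀ u ∈ G, u ≠ 0) (ht : ∀ u ∈ G, u ^ G.card = 1) :
    (G.filter fun x => 1 - x ∈ G).card ^ 3 ≤ 21952 * G.card ^ 2 := by
  have hNt : (G.filter fun x => 1 - x ∈ G).card ≤ G.card := Finset.card_filter_le _ _
  set t := G.card
  rcases Nat.lt_or_ge t 2 with hcard | hcard
  · calc _ ≤ t ^ 3 := Nat.pow_le_pow_left hNt 3
      _ ≤ _ := by interval_cases t <;> norm_num
  obtain ⟨B, hB1, hB2, hB3⟩ := exists_least_cube_gt (n := t) (by omega)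
  have hBt : B ≤ t := hB3 t (by
    calc t = t * 1 := (mul_one t).symm
      _ < t * (t * t) := Nat.mul_lt_mul_of_pos_left (by nlinarith) (by omega)
      _ = t ^ 3 := by ring)
  have htB : t * B ≤ p := by
    refine le_of_pow_le_pow_left₀ (n := 3) (by norm_num) (Nat.zero_le p) ?_
    calc (t * B) ^ 3 = t ^ 3 * B ^ 3 := by ring
      _ ≤ t ^ 3 * (8 * t) := by gcongr
      _ = 8 * t ^ 4 := by ring
      _ ≤ p ^ 3 := hp
  refine card_cube_le_of_le_sq (B := B) ?_ hB2
  refine stepanov_card_le_sq p {((1 : K), (-1) ^ t)} (by simpa using hB1) hBt htB _ ?_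
  intro x hx
  obtain ⟨h1, h2⟩ := Finset.mem_filter.mp hx
  refine ⟨h0 x h1, fun h => h0 _ h2 (by rw [h, sub_self]), ?_⟩
  rw [Finset.mem_singleton, ht x h1, ← neg_sub, neg_pow, ht _ h2, mul_one]

variable [Fintype K]

/-- The number of lines `y = l.1 * x + l.2`, `l ∈ L`, through the point `(x, y)`. -/
def linesThrough (L : Finset (K × K)) (z : K × K) : ℕ :=
  (L.filter fun l => z.2 = l.1 * z.1 + l.2).card

theorem sum_linesThrough (L : Finset (K × K)) :
    ∑ z : K × K, (linesThrough L z : ℝ) = L.card * Fintype.card K := by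
  simp only [linesThrough, Finset.card_filter, Nat.cast_sum, Nat.cast_ite, Nat.cast_one,
    Nat.cast_zero]
  rw [Finset.sum_comm]
  simp only [Fintype.sum_prod_type, Finset.sum_ite_eq', Finset.mem_univ, if_true,
    Finset.sum_const, nsmul_eq_mul, mul_one, Finset.card_univ]

theorem sum_common_points_le (l m : K × K) :
    ∑ z : K × K, ((if z.2 = l.1 * z.1 + l.2 then (1 : ℝ) else 0) *
      (if z.2 = m.1 * z.1 + m.2 then (1 : ℝ) else 0)) ≤
        (if l = m then (Fintype.card K : ℝ) else 0) + 1 := by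
  have h1 : ∀ x : K, ∑ y : K, ((if y = l.1 * x + l.2 then (1 : ℝ) else 0) *
      (if y = m.1 * x + m.2 then (1 : ℝ) else 0)) =
        if l.1 * x + l.2 = m.1 * x + m.2 then 1 else 0 := by
    intro x
    simp [eq_comm]
  rw [Fintype.sum_prod_type]
  simp only [h1]
  split_ifs with h
  · subst h
    simp
  · rw [zero_add, ← Finset.sum_filter, Finset.sum_const, nsmul_eq_mul, mul_one]
    have : (Finset.univ.filter fun x : K => l.1 * x + l.2 = m.1 * x + m.2).card ≤ 1 := by
      rw [Finset.card_le_one]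
      intro x hx y hy
      simp only [Finset.mem_filter, Finset.mem_univ, true_and] at hx hy
      by_contra hxy
      have h2 : (l.1 - m.1) * (x - y) = 0 := by linear_combination hx - hy
      have h3 : l.1 = m.1 :=
        sub_eq_zero.mp ((mul_eq_zero.mp h2).resolve_right (sub_ne_zero.mpr hxy))
      refine h (Prod.ext h3 ?_)
      rw [h3] at hx
      exact add_left_cancel hx
    exact_mod_cast this

theorem sum_linesThrough_sq_le (L : Finset (K × K)) :
    ∑ z : K × K, (linesThrough L z : ℝ) ^ 2 ≤
      L.card * Fintype.card K + (L.card : ℝ) ^ 2 := by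
  simp only [linesThrough, Finset.card_filter, Nat.cast_sum, Nat.cast_ite, Nat.cast_one,
    Nat.cast_zero, sq, Finset.sum_mul_sum]
  rw [Finset.sum_comm]
  calc _ = ∑ l ∈ L, ∑ m ∈ L, ∑ z : K × K, ((if z.2 = l.1 * z.1 + l.2 then (1 : ℝ) else 0) *
      (if z.2 = m.1 * z.1 + m.2 then (1 : ℝ) else 0)) :=
        Finset.sum_congr rfl fun l _ => Finset.sum_comm
    _ ≤ ∑ l ∈ L, ∑ m ∈ L, ((if l = m then (Fintype.card K : ℝ) else 0) + 1) :=
        Finset.sum_le_sum fun l _ => Finset.sum_le_sum fun m _ => sum_common_points_le l m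
    _ = _ := by
        simp only [Finset.sum_add_distrib, Finset.sum_ite_eq, Finset.sum_const, nsmul_eq_mul,
          mul_one]
        rw [← Finset.sum_filter]
        simp

/-- A point-line incidence bound over a finite field. -/
theorem sum_linesThrough_le (L P : Finset (K × K)) :
    ∑ z ∈ P, (linesThrough L z : ℝ) ≤ P.card * L.card / Fintype.card K +
      √(P.card * (L.card * Fintype.card K)) := by
  have hq : (0 : ℝ) < Fintype.card K := Nat.cast_pos.mpr Fintype.card_pos
  set q : ℝ := (Fintype.card K : ℝ) with hqdef
  -- Variance about the mean |L|/q: two distinct lines meet at most once, so only the diagonal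
  -- contributes.
  have hvar : ∑ z : K × K, ((linesThrough L z : ℝ) - L.card / q) ^ 2 ≤ L.card * q := by
    have hexp : ∑ z : K × K, ((linesThrough L z : ℝ) - L.card / q) ^ 2 =
        ∑ z : K × K, (linesThrough L z : ℝ) ^ 2 -
          2 * (L.card / q) * ∑ z : K × K, (linesThrough L z : ℝ) + q * q * (L.card / q) ^ 2 := by
      rw [Finset.mul_sum, ← Finset.sum_sub_distrib]
      have : q * q * (L.card / q) ^ 2 = ∑ z : K × K, ((L.card : ℝ) / q) ^ 2 := by
        rw [Finset.sum_const, nsmul_eq_mul, Finset.card_univ, Fintype.card_prod]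
        push_cast
        rfl
      rw [this, ← Finset.sum_add_distrib]
      exact Finset.sum_congr rfl fun z _ => by ring
    rw [hexp, sum_linesThrough, ← hqdef]
    have h1 := sum_linesThrough_sq_le L
    have h2 : 2 * ((L.card : ℝ) / q) * (L.card * q) = 2 * (L.card : ℝ) ^ 2 := by
      field_simp
    have h3 : q * q * ((L.card : ℝ) / q) ^ 2 = (L.card : ℝ) ^ 2 := by
      field_simp
    rw [h2, h3]
    linarith
  have hcs : (∑ z ∈ P, ((linesThrough L z : ℝ) - L.card / q)) ^ 2 ≤ P.card * (L.card * q) := by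
    refine sq_sum_le_card_mul_sum_sq.trans ?_
    gcongr
    refine le_trans ?_ hvar
    exact Finset.sum_le_sum_of_subset_of_nonneg (Finset.subset_univ P) fun _ _ _ => sq_nonneg _
  have h := Real.le_sqrt_of_sq_le hcs
  rw [Finset.sum_sub_distrib, Finset.sum_const, nsmul_eq_mul] at h
  have h4 : (P.card : ℝ) * L.card / q = P.card * (L.card / q) := by ring
  rw [h4]
  linarith

/-- For z ∈ G × G, every solution x gives the line of slope z₂x/z₁ and intercept z₂(1 − x), both in
G, passing through z. Thus |G|² points each meet at least |Q| of |G|² lines. -/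
theorem card_unit_sums_le {G : Finset K} (h1 : 1 ∈ G) (h0 : ∀ u ∈ G, u ≠ 0)
    (hmul : ∀ u ∈ G, ∀ v ∈ G, u * v ∈ G) (hinv : ∀ u ∈ G, u⁻¹ ∈ G) :
    ((G.filter fun x => 1 - x ∈ G).card : ℝ) ≤
      (G.card : ℝ) ^ 2 / Fintype.card K + √(Fintype.card K) := by
  set Q := G.filter fun x => 1 - x ∈ G with hQ
  have hcount : ∀ z ∈ G ×ˢ G, Q.card ≤ linesThrough (G ×ˢ G) z := by
    intro z hz
    obtain ⟨hz1, hz2⟩ := Finset.mem_product.mp hz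
    refine Finset.card_le_card_of_injOn (fun x => (z.2 * x * z.1⁻¹, z.2 * (1 - x))) ?_ ?_
    · intro x hx
      obtain ⟨hx1, hx2⟩ := Finset.mem_filter.mp hx
      refine Finset.mem_filter.mpr ⟨Finset.mem_product.mpr
        ⟨hmul _ (hmul _ hz2 _ hx1) _ (hinv _ hz1), hmul _ hz2 _ hx2⟩, ?_⟩
      simp only
      rw [inv_mul_cancel_right₀ (h0 _ hz1)]
      ring
    · intro x _ y _ hxy
      have h2 := mul_left_cancel₀ (h0 _ hz2) (congrArg Prod.snd hxy)
      linear_combination -h2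
  have ht : (0 : ℝ) < G.card := Nat.cast_pos.mpr (Finset.card_pos.mpr ⟨1, h1⟩)
  have hsum := sum_linesThrough_le (G ×ˢ G) (G ×ˢ G)
  have hlow : (G.card : ℝ) ^ 2 * Q.card ≤ ∑ z ∈ G ×ˢ G, (linesThrough (G ×ˢ G) z : ℝ) := by
    have : ((G ×ˢ G).card : ℝ) * Q.card ≤ ∑ z ∈ G ×ˢ G, (linesThrough (G ×ˢ G) z : ℝ) := by
      rw [← nsmul_eq_mul]
      exact Finset.card_nsmul_le_sum _ _ _ fun z hz => by exact_mod_cast hcount z hz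
    rw [Finset.card_product] at this
    push_cast at this
    rwa [sq]
  have hsqrt : √(((G ×ˢ G).card : ℝ) * ((G ×ˢ G).card * Fintype.card K)) =
      (G.card : ℝ) ^ 2 * √(Fintype.card K) := by
    rw [← mul_assoc, Real.sqrt_mul (by positivity), Real.sqrt_mul_self (by positivity),
      Finset.card_product]
    push_cast
    ring
  rw [hsqrt, Finset.card_product] at hsum
  push_cast at hsum
  have h := hlow.trans hsum
  have h2 : (G.card : ℝ) ^ 2 * Q.card ≤
      (G.card : ℝ) ^ 2 * ((G.card : ℝ) ^ 2 / Fintype.card K + √(Fintype.card K)) := by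
    refine h.trans (le_of_eq ?_)
    ring
  exact le_of_mul_le_mul_left h2 (by positivity)

end UnitSums

/-! ### Subgroups with constant difference multiplicity. -/

section ConstDifference

variable {p : ℕ} [Fact p.Prime]

theorem mem_elems {H : Subgroup (ZMod p)ˣ} {x : ZMod p} :
    x ∈ elems H ↔ ∃ u ∈ H, (u : ZMod p) = x := by
  simp [elems]

theorem card_elems (H : Subgroup (ZMod p)ˣ) : (elems H).card = Nat.card H := by
  rw [elems, ← Set.ncard_eq_toFinset_card, Set.ncard_image_of_injective _ Units.val_injective]
  rfl

theorem one_mem_elems (H : Subgroup (ZMod p)ˣ) : (1 : ZMod p) ∈ elems H :=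
  mem_elems.mpr ⟨1, H.one_mem, rfl⟩

theorem ne_zero_of_mem_elems {H : Subgroup (ZMod p)ˣ} : ∀ x ∈ elems H, x ≠ 0 := by
  intro x hx
  obtain ⟨u, -, rfl⟩ := mem_elems.mp hx
  exact u.ne_zero

theorem mul_mem_elems {H : Subgroup (ZMod p)ˣ} : ∀ x ∈ elems H, ∀ y ∈ elems H, x * y ∈ elems H := by
  intro x hx y hy
  obtain ⟨u, hu, rfl⟩ := mem_elems.mp hx
  obtain ⟨v, hv, rfl⟩ := mem_elems.mp hy
  exact mem_elems.mpr ⟨u * v, H.mul_mem hu hv, rfl⟩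

theorem inv_mem_elems {H : Subgroup (ZMod p)ˣ} : ∀ x ∈ elems H, x⁻¹ ∈ elems H := by
  intro x hx
  obtain ⟨u, hu, rfl⟩ := mem_elems.mp hx
  exact mem_elems.mpr ⟨u⁻¹, H.inv_mem hu, Units.val_inv_eq_inv_val u⟩

theorem pow_card_elems {H : Subgroup (ZMod p)ˣ} : ∀ x ∈ elems H, x ^ (elems H).card = 1 := by
  intro x hx
  obtain ⟨u, hu, rfl⟩ := mem_elems.mp hx
  have h : (⟨u, hu⟩ : H) ^ Nat.card H = 1 := pow_card_eq_one'
  rw [card_elems]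
  have h' : u ^ Nat.card H = 1 := congrArg Subtype.val h
  rw [← Units.val_pow_eq_pow_val, h', Units.val_one]

theorem card_elems_pos (H : Subgroup (ZMod p)ˣ) : 0 < (elems H).card :=
  Finset.card_pos.mpr ⟨1, one_mem_elems H⟩

theorem card_elems_le (H : Subgroup (ZMod p)ˣ) : (elems H).card ≤ p := by
  simpa [ZMod.card] using Finset.card_le_univ (elems H)

theorem card_elems_top : (elems (⊤ : Subgroup (ZMod p)ˣ)).card = p - 1 := by
  rw [card_elems, Subgroup.card_top, Nat.card_eq_fintype_card, ZMod.card_units]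

theorem correlation_charFn (S : Finset (ZMod p)) (x : ZMod p) :
    correlation (charFn S) (charFn S) x = ((S.filter fun y => y + x ∈ S).card : ℝ) := by
  simp only [correlation, charFn, ← ite_and, mul_ite, mul_one, mul_zero]
  rw [Finset.card_filter, Nat.cast_sum, ← Finset.sum_subset (Finset.subset_univ S)]
  · refine Finset.sum_congr rfl fun y hy => ?_
    simp [hy]
  · intro y _ hy
    simp [hy]

theorem sum_correlation (S : Finset (ZMod p)) :
    ∑ x, correlation (charFn S) (charFn S) x = (S.card : ℝ) ^ 2 := by
  simp only [correlation]
  rw [Finset.sum_comm]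
  simp only [← Finset.mul_sum]
  have h : ∀ y, ∑ x, charFn S (y + x) = (S.card : ℝ) := by
    intro y
    refine (Equiv.sum_comp (Equiv.addLeft y) (charFn S)).trans ?_
    simp [charFn]
  simp only [h]
  rw [← Finset.sum_mul, sq]
  simp [charFn]

theorem correlation_eq_zero {S : Finset (ZMod p)} {x : ZMod p} (hx : x ∉ S - S) :
    correlation (charFn S) (charFn S) x = 0 := by
  rw [correlation_charFn, Nat.cast_eq_zero, Finset.card_eq_zero, Finset.filter_eq_empty_iff]
  intro y hy hyx
  exact hx (Finset.mem_sub.mpr ⟨y + x, hyx, y, hy, by ring⟩)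

theorem addEnergy_eq_sum_correlation (S : Finset (ZMod p)) :
    (S.addEnergy S : ℝ) = ∑ x, correlation (charFn S) (charFn S) x ^ 2 := by
  have h : ∀ x, correlation (charFn S) (charFn S) x ^ 2 =
      ∑ y, ∑ z, if y ∈ S ∧ y + x ∈ S ∧ z ∈ S ∧ z + x ∈ S then (1 : ℝ) else 0 := by
    intro x
    rw [sq, correlation, Finset.sum_mul_sum]
    refine Finset.sum_congr rfl fun y _ => Finset.sum_congr rfl fun z _ => ?_
    simp only [charFn]
    split_ifs <;> simp_all
  simp only [h]
  simp only [← Fintype.sum_prod_type']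
  rw [← Finset.sum_filter, Finset.sum_const, nsmul_eq_mul, mul_one, Finset.addEnergy]
  congr 1
  -- An additive quadruple a + c = b + d is encoded by the common difference x = b − a = c − d and
  -- the starting points a, d.
  refine Finset.card_nbij' (fun q => (q.1.2 - q.1.1, q.1.1, q.2.2))
    (fun r => ((r.2.1, r.2.1 + r.1), (r.2.2 + r.1, r.2.2))) ?_ ?_ ?_ ?_
  · rintro ⟨⟨a, b⟩, c, d⟩ hq
    simp only [Finset.coe_filter, Finset.mem_product, Set.mem_ofPred_eq] at hq
    obtain ⟨⟨⟨ha, hb⟩, hc, hd⟩, h⟩ := hq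
    simp only [Finset.coe_filter, Finset.mem_univ, true_and, Set.mem_ofPred_eq]
    refine ⟨ha, by simpa using hb, hd, ?_⟩
    have : d + (b - a) = c := by linear_combination -h
    rwa [this]
  · rintro ⟨x, y, z⟩ hr
    simp only [Finset.coe_filter, Finset.mem_univ, true_and, Set.mem_ofPred_eq] at hr
    simp only [Finset.coe_filter, Finset.mem_product, Set.mem_ofPred_eq]
    exact ⟨⟨⟨hr.1, hr.2.1⟩, hr.2.2.2, hr.2.2.1⟩, by ring⟩
  · rintro ⟨⟨a, b⟩, c, d⟩ hq
    simp only [Finset.coe_filter, Finset.mem_product, Set.mem_ofPred_eq] at hq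
    have : d + (b - a) = c := by linear_combination -hq.2
    simp [this]
  · rintro ⟨x, y, z⟩ _
    simp

variable {A Γ : Subgroup (ZMod p)ˣ} {ξ : ZMod p} {c : ℝ}

theorem zero_notMem_smul_elems (hξ : ξ ≠ 0) : (0 : ZMod p) ∉ ξ • elems Γ := by
  intro h
  obtain ⟨y, hy, hxy⟩ := Finset.mem_smul_finset.mp h
  exact mul_ne_zero hξ (ne_zero_of_mem_elems y hy) hxy

/-- A ∘ A equals |A| at 0, c on ξΓ and 0 elsewhere. The first moment gives the counting identity,
the second the energy. -/
theorem IsConstDifference.sum_eq (h : IsConstDifference A Γ ξ c) (n : ℕ) (hn : n ≠ 0) :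
    ∑ x, correlation (charFn (elems A)) (charFn (elems A)) x ^ n =
      ((elems A).card : ℝ) ^ n + c ^ n * ((elems Γ).card : ℝ) := by
  obtain ⟨hξ, hdiff, hconst⟩ := h
  rw [← Finset.sum_subset (Finset.subset_univ (ξ • elems Γ ∪ {0}))]
  · rw [Finset.sum_union (Finset.disjoint_singleton_right.mpr (zero_notMem_smul_elems hξ)),
      Finset.sum_singleton, Finset.sum_congr rfl fun x hx => by rw [hconst x hx],
      Finset.sum_const, nsmul_eq_mul, correlation_charFn]
    have h0 : ((elems A).filter fun y => y + 0 ∈ elems A) = elems A := by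
      simp
    have h1 : (ξ • elems Γ).card = (elems Γ).card :=
      Finset.card_image_of_injective _ (mul_right_injective₀ hξ)
    rw [h0, h1]
    ring
  · intro x _ hx
    rw [← hdiff] at hx
    rw [correlation_eq_zero hx, zero_pow hn]

theorem IsConstDifference.card_sq (h : IsConstDifference A Γ ξ c) :
    ((elems A).card : ℝ) ^ 2 - ((elems A).card : ℝ) = c * ((elems Γ).card : ℝ) := by
  have h1 := h.sum_eq 1 one_ne_zero
  simp only [pow_one] at h1
  rw [sum_correlation] at h1
  linarith

theorem IsConstDifference.addEnergy_eq (h : IsConstDifference A Γ ξ c) :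
    ((elems A).addEnergy (elems A) : ℝ) =
      ((elems A).card : ℝ) ^ 2 + c ^ 2 * ((elems Γ).card : ℝ) := by
  rw [addEnergy_eq_sum_correlation, h.sum_eq 2 two_ne_zero]

theorem IsConstDifference.one_le (h : IsConstDifference A Γ ξ c) : 1 ≤ c := by
  obtain ⟨hξ, hdiff, hconst⟩ := h
  have hmem : ξ ∈ ξ • elems Γ :=
    Finset.mem_smul_finset.mpr ⟨1, one_mem_elems Γ, by simp⟩
  have h1 : ξ ∈ elems A - elems A := by
    rw [hdiff]; exact Finset.mem_union_left _ hmem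
  obtain ⟨y, hy, z, hz, hyz⟩ := Finset.mem_sub.mp h1
  rw [← hconst ξ hmem, correlation_charFn]
  have : 0 < ((elems A).filter fun w => w + ξ ∈ elems A).card := by
    refine Finset.card_pos.mpr ⟨z, Finset.mem_filter.mpr ⟨hz, ?_⟩⟩
    rwa [← hyz, add_sub_cancel]
  exact_mod_cast this

theorem IsConstDifference.card_le_sq (h : IsConstDifference A Γ ξ c) :
    ((elems Γ).card : ℝ) ≤ ((elems A).card : ℝ) ^ 2 := by
  have h1 := h.card_sq
  have h2 := h.one_le
  have h3 : (0 : ℝ) ≤ (elems A).card := Nat.cast_nonneg _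
  have h4 : (0 : ℝ) ≤ (elems Γ).card := Nat.cast_nonneg _
  nlinarith

theorem IsConstDifference.two_le_card (h : IsConstDifference A Γ ξ c) : 2 ≤ (elems A).card := by
  by_contra hlt
  have h0 := card_elems_pos A
  have h1 : (elems A).card = 1 := by omega
  have h2 := h.card_sq
  have h3 := h.one_le
  have h4 : (1 : ℝ) ≤ (elems Γ).card := by exact_mod_cast card_elems_pos Γ
  rw [h1] at h2
  norm_num at h2
  rcases h2 with h2 | h2
  · linarith
  · rw [h2] at h4; norm_num at h4

theorem IsConstDifference.div_mem (h : IsConstDifference A Γ ξ c) {u v w z : ZMod p}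
    (hu : u ∈ elems A) (hv : v ∈ elems A) (hw : w ∈ elems A) (hz : z ∈ elems A)
    (huv : u ≠ v) (hwz : w ≠ z) : (u - v) / (w - z) ∈ elems Γ := by
  obtain ⟨hξ, hdiff, -⟩ := h
  have key : ∀ a ∈ elems A, ∀ b ∈ elems A, a ≠ b → ∃ y ∈ elems Γ, a - b = ξ * y := by
    intro a ha b hb hab
    have h1 : a - b ∈ ξ • elems Γ ∪ {0} := by
      rw [← hdiff]; exact Finset.sub_mem_sub ha hb
    rcases Finset.mem_union.mp h1 with h2 | h2
    · obtain ⟨y, hy, hxy⟩ := Finset.mem_smul_finset.mp h2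
      exact ⟨y, hy, hxy.symm⟩
    · exact absurd (sub_eq_zero.mp (Finset.mem_singleton.mp h2)) hab
  obtain ⟨y, hy, h1⟩ := key u hu v hv huv
  obtain ⟨y', hy', h2⟩ := key w hw z hz hwz
  rw [h1, h2, mul_div_mul_left _ _ hξ, div_eq_mul_inv]
  exact mul_mem_elems _ hy _ (inv_mem_elems _ hy')

/-- For l ∉ Γ the map (a, b) ↦ a + lb is injective on A × A: a collision would write l as a ratio of
differences, hence as an element of Γ. -/
theorem IsConstDifference.card_mul_card_le (h : IsConstDifference A Γ ξ c) (hΓ : Γ ≠ ⊤) :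
    (elems A).card * (elems A).card ≤ p := by
  obtain ⟨l, hl⟩ : ∃ l : (ZMod p)ˣ, l ∉ Γ := by
    by_contra! hall
    exact hΓ ((Subgroup.eq_top_iff' Γ).mpr hall)
  have hl' : (l : ZMod p) ∉ elems Γ := by
    intro hmem
    obtain ⟨u, hu, hul⟩ := mem_elems.mp hmem
    exact hl (Units.ext hul ▸ hu)
  rw [← Finset.card_product]
  calc (elems A ×ˢ elems A).card ≤ (Finset.univ : Finset (ZMod p)).card := by
        refine Finset.card_le_card_of_injOn (fun x => x.1 + l * x.2)
          (fun _ _ => Finset.mem_coe.mpr (Finset.mem_univ _)) ?_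
        rintro ⟨a, b⟩ hx ⟨a', b'⟩ hy hxy
        obtain ⟨ha, hb⟩ := Finset.mem_product.mp (Finset.mem_coe.mp hx)
        obtain ⟨ha', hb'⟩ := Finset.mem_product.mp (Finset.mem_coe.mp hy)
        simp only at hxy ha hb ha' hb'
        have hbb : b = b' := by
          by_contra hne
          have hne' : b' - b ≠ 0 := sub_ne_zero.mpr (Ne.symm hne)
          have h1 : a - a' = l * (b' - b) := by linear_combination hxy
          have hane : a ≠ a' := by
            intro heq
            rw [heq, sub_self] at h1
            exact mul_ne_zero l.ne_zero hne' h1.symm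
          have h2 := h.div_mem ha ha' hb' hb hane (Ne.symm hne)
          rw [h1, mul_div_cancel_right₀ _ hne'] at h2
          exact hl' h2
        subst hbb
        exact Prod.ext (add_right_cancel hxy) rfl
    _ = p := by rw [Finset.card_univ, ZMod.card]

/-- The ratios `(u - 1) / (v - 1)` with `u ≠ v` lie in `Γ ∩ (1 - Γ)`. -/
theorem IsConstDifference.le_sum_shiftRep (h : IsConstDifference A Γ ξ c) :
    ((elems A).card - 1) * ((elems A).card - 2) ≤
      ∑ ρ ∈ (elems Γ).filter (fun x => 1 - x ∈ elems Γ), shiftRep (elems A) ρ := by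
  have hcard : ((elems A).erase 1).offDiag.card = ((elems A).card - 1) * ((elems A).card - 2) := by
    rw [Finset.offDiag_card, Finset.card_erase_of_mem (one_mem_elems A)]
    obtain ⟨k, hk⟩ : ∃ k, (elems A).card = k + 2 := ⟨_, (Nat.sub_add_cancel h.two_le_card).symm⟩
    rw [hk]
    have : k + 2 - 1 = k + 1 := rfl
    rw [this, Nat.add_sub_cancel, Nat.mul_succ, Nat.add_sub_cancel]
  rw [← hcard]
  refine le_trans (Finset.card_le_card ?_) (Finset.card_biUnion_le)
  rintro ⟨u, v⟩ huv
  rw [Finset.mem_offDiag, Finset.mem_erase, Finset.mem_erase] at huv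
  obtain ⟨⟨hu1, hu⟩, ⟨hv1, hv⟩, hne⟩ := huv
  have hv' : v - 1 ≠ 0 := sub_ne_zero.mpr hv1
  refine Finset.mem_biUnion.mpr ⟨(u - 1) / (v - 1), Finset.mem_filter.mpr
    ⟨h.div_mem hu (one_mem_elems A) hv (one_mem_elems A) hu1 hv1, ?_⟩, ?_⟩
  · have h1 : 1 - (u - 1) / (v - 1) = (v - u) / (v - 1) := by
      field_simp
      ring
    rw [h1]
    exact h.div_mem hv hu hv (one_mem_elems A) (Ne.symm hne) hv1
  · rw [Finset.mem_filter, Finset.mem_product, Finset.mem_erase, Finset.mem_erase]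
    refine ⟨⟨⟨hu1, hu⟩, hv1, hv⟩, ?_⟩
    simp only
    field_simp

/-- Cauchy–Schwarz between the lower bound for the number of pairs and the energy bound. For |A| ≥ 3
one has (m − 1)(m − 2) ≥ (2/9)m², and 1333584 = 65856·81/4. -/
theorem IsConstDifference.card_sq_le (h : IsConstDifference A Γ ξ c) (hΓ : Γ ≠ ⊤)
    (hA : 3 ≤ (elems A).card) :
    ((elems A).card : ℝ) ^ 2 ≤
      1333584 * ((elems Γ).filter fun x => 1 - x ∈ elems Γ).card *
        (1 + Real.log (elems A).card) := by
  set m := (elems A).card with hm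
  set Q := (elems Γ).filter fun x => 1 - x ∈ elems Γ with hQ
  have hQ01 : ∀ ρ ∈ Q, ρ ≠ 0 ∧ ρ ≠ 1 := by
    intro ρ hρ
    obtain ⟨h1, h2⟩ := Finset.mem_filter.mp hρ
    refine ⟨ne_zero_of_mem_elems _ h1, ?_⟩
    rintro rfl
    exact ne_zero_of_mem_elems _ h2 (sub_self 1)
  have henergy := sum_shiftRep_sq_le p (one_mem_elems A) (h.card_mul_card_le hΓ)
    ne_zero_of_mem_elems pow_card_elems Q hQ01
  have hcs := sq_sum_le_card_mul_sum_sq (s := Q) (f := fun ρ => (shiftRep (elems A) ρ : ℝ))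
  have hlow : ((m : ℝ) - 1) * (m - 2) ≤ ∑ ρ ∈ Q, (shiftRep (elems A) ρ : ℝ) := by
    have h1 : (((m - 1) * (m - 2) : ℕ) : ℝ) ≤ ((∑ ρ ∈ Q, shiftRep (elems A) ρ : ℕ) : ℝ) :=
      Nat.cast_le.mpr h.le_sum_shiftRep
    push_cast [Nat.cast_sub (show 1 ≤ m by omega), Nat.cast_sub (show 2 ≤ m by omega)] at h1
    exact h1
  have hm3 : (3 : ℝ) ≤ m := by exact_mod_cast hA
  have hq : 2 / 9 * (m : ℝ) ^ 2 ≤ ((m : ℝ) - 1) * (m - 2) := by nlinarith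
  have hsq : (2 / 9 * (m : ℝ) ^ 2) ^ 2 ≤ (∑ ρ ∈ Q, (shiftRep (elems A) ρ : ℝ)) ^ 2 :=
    pow_le_pow_left₀ (by positivity) (hq.trans hlow) 2
  have hfin : (2 / 9 * (m : ℝ) ^ 2) ^ 2 ≤
      Q.card * (65856 * (m : ℝ) ^ 2 * (1 + Real.log m)) :=
    (hsq.trans hcs).trans (mul_le_mul_of_nonneg_left henergy (Nat.cast_nonneg _))
  have hpos : (0 : ℝ) < 4 / 81 * (m : ℝ) ^ 2 := by positivity
  refine le_of_mul_le_mul_left ?_ hpos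
  calc 4 / 81 * (m : ℝ) ^ 2 * (m : ℝ) ^ 2 = (2 / 9 * (m : ℝ) ^ 2) ^ 2 := by ring
    _ ≤ _ := hfin
    _ = _ := by ring

end ConstDifference

/-! ### Small and large Γ. -/

section Dichotomy

theorem one_add_log_le_two_mul_sqrt {x : ℝ} (hx : 0 < x) : 1 + Real.log x ≤ 2 * √x := by
  have h1 := Real.log_le_sub_one_of_pos (Real.sqrt_pos.mpr hx)
  rw [Real.log_sqrt hx.le] at h1
  linarith

theorem log_le_logb_two {x : ℝ} (hx : 1 ≤ x) : Real.log x ≤ Real.logb 2 x := by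
  rw [Real.logb, le_div_iff₀ (Real.log_pos one_lt_two)]
  have h1 : Real.log 2 ≤ 1 := by linarith [Real.log_two_lt_d9]
  nlinarith [Real.log_nonneg hx]

theorem one_le_logb_two {x : ℝ} (hx : 2 ≤ x) : 1 ≤ Real.logb 2 x := by
  rw [Real.le_logb_iff_rpow_le one_lt_two (by linarith)]
  simpa using hx

theorem logb_two_le_four_mul_sqrt {x : ℝ} (hx : 1 ≤ x) : Real.logb 2 x ≤ 4 * √x := by
  rw [Real.logb, div_le_iff₀ (Real.log_pos one_lt_two)]
  have h1 : 1 / 2 ≤ Real.log 2 := by linarith [Real.log_two_gt_d9]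
  have h2 := one_add_log_le_two_mul_sqrt (x := x) (by linarith)
  nlinarith [Real.sqrt_nonneg x]

variable {p : ℕ} [Fact p.Prime] {A Γ : Subgroup (ZMod p)ˣ} {ξ : ZMod p} {c : ℝ}

theorem IsConstDifference.card_le_of_small (h : IsConstDifference A Γ ξ c) (hΓ : Γ ≠ ⊤)
    (hA : 3 ≤ (elems A).card) (hsmall : 8 * (elems Γ).card ^ 4 ≤ p ^ 3) :
    ((elems A).card : ℝ) ≤ (1333584 ^ 3 * 21952 * 8) ^ 2 := by
  have hN := card_unit_sums_cube_le p hsmall ne_zero_of_mem_elems pow_card_elems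
  have hN' : (((elems Γ).filter fun x => 1 - x ∈ elems Γ).card : ℝ) ^ 3 ≤
      21952 * ((elems Γ).card : ℝ) ^ 2 := by exact_mod_cast hN
  have hmain := h.card_sq_le hΓ hA
  have ht := h.card_le_sq
  have ht0 : (0 : ℝ) ≤ (elems Γ).card := Nat.cast_nonneg _
  have hN0 : (0 : ℝ) ≤ ((elems Γ).filter fun x => 1 - x ∈ elems Γ).card := Nat.cast_nonneg _
  have hm : (0 : ℝ) < (elems A).card := Nat.cast_pos.mpr (by omega)
  generalize (((elems Γ).filter fun x => 1 - x ∈ elems Γ).card : ℝ) = N at *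
  generalize ((elems Γ).card : ℝ) = t at *
  generalize ((elems A).card : ℝ) = m at *
  -- With m = s² the logarithm is at most 2s. Cubing m² ≪ |Q|·s and using |Q|³ ≪ t² ≤ m^4 leaves
  -- s^12 ≪ s^11.
  obtain ⟨s, hs, rfl⟩ : ∃ s : ℝ, 0 < s ∧ m = s ^ 2 :=
    ⟨√m, Real.sqrt_pos.mpr hm, (Real.sq_sqrt hm.le).symm⟩
  have hlog : 1 + Real.log (s ^ 2) ≤ 2 * s := by
    simpa [Real.sqrt_sq hs.le] using one_add_log_le_two_mul_sqrt hm
  have h1 : (s ^ 2) ^ 2 ≤ 1333584 * N * (2 * s) :=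
    hmain.trans (mul_le_mul_of_nonneg_left hlog (by positivity))
  have h2 : ((s ^ 2) ^ 2) ^ 3 ≤ (1333584 * N * (2 * s)) ^ 3 :=
    pow_le_pow_left₀ (by positivity) h1 3
  have h3 : N ^ 3 ≤ 21952 * ((s ^ 2) ^ 2) ^ 2 :=
    hN'.trans (mul_le_mul_of_nonneg_left (pow_le_pow_left₀ ht0 ht 2) (by norm_num))
  have h4 : s ^ 11 * s ≤ s ^ 11 * (1333584 ^ 3 * 21952 * 8) := by
    calc s ^ 11 * s = ((s ^ 2) ^ 2) ^ 3 := by ring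
      _ ≤ (1333584 * N * (2 * s)) ^ 3 := h2
      _ = 1333584 ^ 3 * 8 * s ^ 3 * N ^ 3 := by ring
      _ ≤ 1333584 ^ 3 * 8 * s ^ 3 * (21952 * ((s ^ 2) ^ 2) ^ 2) := by gcongr
      _ = _ := by ring
  exact pow_le_pow_left₀ hs.le (le_of_mul_le_mul_left h4 (by positivity)) 2

theorem IsConstDifference.mul_card_sq_le_of_large (h : IsConstDifference A Γ ξ c) (hΓ : Γ ≠ ⊤)
    (hA : 3 ≤ (elems A).card) (hlarge : p ^ 3 < 8 * (elems Γ).card ^ 4) :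
    (p : ℝ) * ((elems A).card : ℝ) ^ 2 ≤
      10668672 * ((elems Γ).card : ℝ) ^ 2 * Real.logb 2 (elems A).card := by
  have hN := card_unit_sums_le (one_mem_elems Γ) ne_zero_of_mem_elems mul_mem_elems inv_mem_elems
  rw [ZMod.card] at hN
  have hmain := h.card_sq_le hΓ hA
  have hm : (3 : ℝ) ≤ (elems A).card := by exact_mod_cast hA
  have hlog1 := log_le_logb_two (x := (elems A).card) (by linarith)
  have hlog2 := one_le_logb_two (x := (elems A).card) (by linarith)
  have hp : (0 : ℝ) < p := Nat.cast_pos.mpr (Fact.out : p.Prime).pos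
  have hlarge' : (p : ℝ) ^ 3 < 8 * ((elems Γ).card : ℝ) ^ 4 := by exact_mod_cast hlarge
  -- Largeness of Γ makes the error √p in the incidence bound at most 3|Γ|²/p.
  have hsqrt : p * √(p : ℝ) ≤ 3 * ((elems Γ).card : ℝ) ^ 2 := by
    refine le_of_pow_le_pow_left₀ two_ne_zero (by positivity) ?_
    rw [mul_pow, Real.sq_sqrt hp.le]
    nlinarith [pow_nonneg (Nat.cast_nonneg (α := ℝ) (elems Γ).card) 4]
  have hN' : (p : ℝ) * ((elems Γ).filter fun x => 1 - x ∈ elems Γ).card ≤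
      4 * ((elems Γ).card : ℝ) ^ 2 := by
    have h1 := mul_le_mul_of_nonneg_left hN hp.le
    rw [mul_add, mul_div_cancel₀ _ hp.ne'] at h1
    linarith
  calc (p : ℝ) * ((elems A).card : ℝ) ^ 2
      ≤ p * (1333584 * ((elems Γ).filter fun x => 1 - x ∈ elems Γ).card *
        (1 + Real.log (elems A).card)) := mul_le_mul_of_nonneg_left hmain hp.le
    _ ≤ p * (1333584 * ((elems Γ).filter fun x => 1 - x ∈ elems Γ).card *
        (2 * Real.logb 2 (elems A).card)) := by
        gcongr
        linarith
    _ = 2667168 * (p * ((elems Γ).filter fun x => 1 - x ∈ elems Γ).card) *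
        Real.logb 2 (elems A).card := by ring
    _ ≤ 2667168 * (4 * ((elems Γ).card : ℝ) ^ 2) * Real.logb 2 (elems A).card := by
        gcongr
    _ = _ := by ring

/-- Either `A` is bounded, or `|A|` is at most about `|Γ| p ^ (-1 / 2)`. -/
theorem exists_card_bounds : ∃ M : ℝ, 1 ≤ M ∧ ∃ C : ℝ, 2 ≤ C ∧
    ∀ (p : ℕ) [Fact p.Prime] (A Γ : Subgroup (ZMod p)ˣ) (ξ : ZMod p) (c : ℝ),
      IsConstDifference A Γ ξ c → Γ ≠ ⊤ → ((elems A).card : ℝ) ≤ M ∨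
        (p : ℝ) * ((elems A).card : ℝ) ^ 2 ≤
          C * ((elems Γ).card : ℝ) ^ 2 * Real.logb 2 (elems A).card := by
  refine ⟨(1333584 ^ 3 * 21952 * 8) ^ 2, by norm_num, 10668672, by norm_num, ?_⟩
  intro p _ A Γ ξ c h hΓ
  rcases Nat.lt_or_ge (elems A).card 3 with hA | hA
  · left
    have : ((elems A).card : ℝ) < 3 := by exact_mod_cast hA
    exact this.le.trans (by norm_num)
  rcases le_or_gt (8 * (elems Γ).card ^ 4) (p ^ 3) with hs | hs
  · exact Or.inl (h.card_le_of_small hΓ hA hs)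
  · exact Or.inr (h.mul_card_sq_le_of_large hΓ hA hs)

end Dichotomy

/-! ### Deduction of both claims. -/

theorem corollaryc :
    (∃ K : ℝ, 0 < K ∧ ∃ κ : ℝ, 0 < κ ∧
      ∀ (p : ℕ) [Fact p.Prime] (A Γ : Subgroup (ZMod p)ˣ) (ξ : ZMod p) (c : ℝ),
        IsConstDifference A Γ ξ c →
          ((elems A).card : ℝ) ^ 2 - ((elems A).card : ℝ) = c * ((elems Γ).card : ℝ) ∧
          (((elems Γ).card : ℝ) ≤ K ∨
            κ * ((p : ℝ) / Real.logb 2 (p : ℝ)) ≤ ((elems Γ).card : ℝ))) ∧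
    (∀ δ : ℝ, 0 < δ → ∃ C : ℝ, 0 < C ∧
      ∀ (p : ℕ) [Fact p.Prime] (A Γ : Subgroup (ZMod p)ˣ) (ξ : ZMod p) (c : ℝ),
        IsConstDifference A Γ ξ c → Γ ≠ ⊤ →
        δ * ((p : ℝ) / Real.logb 2 (p : ℝ)) ≤ ((elems Γ).card : ℝ) →
          ((elems A).addEnergy (elems A) : ℝ) ≤
            C * (((elems Γ).card : ℝ) / (p : ℝ) * ((elems A).card : ℝ) ^ 2 *
              Real.logb 2 ((elems A).card : ℝ)) ∧
          c ^ 2 ≤ C * (((elems A).card : ℝ) ^ 2 * Real.logb 2 ((elems A).card : ℝ) / (p : ℝ))) := by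
  obtain ⟨M, hM, C, hC, hbound⟩ := exists_card_bounds
  constructor
  -- |A| ≤ M gives |Γ| ≤ |A|² ≤ M². In the excluded case Γ = 𝔽_p^*, |Γ| = p − 1 ≥ p/2, which
  -- suffices since C ≥ 2.
  · refine ⟨M ^ 2, by positivity, 1 / C, by positivity, ?_⟩
    intro p _ A Γ ξ c h
    refine ⟨h.card_sq, ?_⟩
    have hp2 : (2 : ℝ) ≤ p := by exact_mod_cast (Fact.out : p.Prime).two_le
    have hlogp := one_le_logb_two hp2
    have hlogp0 : 0 < Real.logb 2 (p : ℝ) := by linarith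
    have ht : (0 : ℝ) < (elems Γ).card := Nat.cast_pos.mpr (card_elems_pos Γ)
    by_cases hΓ : Γ = ⊤
    · right
      have hcard : ((elems Γ).card : ℝ) = p - 1 := by
        rw [hΓ, card_elems_top, Nat.cast_sub (Fact.out : p.Prime).one_le, Nat.cast_one]
      rw [hcard]
      calc 1 / C * ((p : ℝ) / Real.logb 2 (p : ℝ)) ≤ 1 / 2 * (p / 1) := by gcongr
        _ ≤ p - 1 := by linarith
    · rcases hbound p A Γ ξ c h hΓ with hm | hm
      · left
        exact h.card_le_sq.trans (pow_le_pow_left₀ (Nat.cast_nonneg _) hm 2)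
      · right
        have hm2 : (2 : ℝ) ≤ (elems A).card := by exact_mod_cast h.two_le_card
        have hmp : Real.logb 2 ((elems A).card : ℝ) ≤ Real.logb 2 (p : ℝ) :=
          Real.logb_le_logb_of_le one_lt_two (by linarith) (by exact_mod_cast card_elems_le A)
        have h1 : ((elems Γ).card : ℝ) * p ≤
            (elems Γ).card * (C * (elems Γ).card * Real.logb 2 (p : ℝ)) := by
          calc ((elems Γ).card : ℝ) * p ≤ ((elems A).card : ℝ) ^ 2 * p := by
                gcongr; exact h.card_le_sq
            _ = p * ((elems A).card : ℝ) ^ 2 := mul_comm _ _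
            _ ≤ _ := hm
            _ ≤ C * ((elems Γ).card : ℝ) ^ 2 * Real.logb 2 (p : ℝ) := by gcongr
            _ = _ := by ring
        have h2 := le_of_mul_le_mul_left h1 ht
        have hC0 : 0 < C := by linarith
        rw [div_mul_div_comm, one_mul, div_le_iff₀ (by positivity)]
        linarith
  · intro δ hδ
    -- P bounds p when |A| ≤ M: then δp/log p ≤ |Γ| ≤ M², while log p ≤ 4√p.
    set P := (4 * M ^ 2 / δ) ^ 2 with hP
    have hP0 : 0 < P := by positivity
    refine ⟨2 * C + 2 * M ^ 2 * P, by positivity, ?_⟩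
    intro p _ A Γ ξ c h hΓ hδΓ
    have hp2 : (2 : ℝ) ≤ p := by exact_mod_cast (Fact.out : p.Prime).two_le
    have hp0 : (0 : ℝ) < p := by linarith
    have hlogp := one_le_logb_two hp2
    have hlogp0 : 0 < Real.logb 2 (p : ℝ) := by linarith
    have ht1 : (1 : ℝ) ≤ (elems Γ).card := by exact_mod_cast card_elems_pos Γ
    have hm2 : (2 : ℝ) ≤ (elems A).card := by exact_mod_cast h.two_le_card
    have hlogm := one_le_logb_two hm2
    have hc1 := h.one_le
    have hct := h.card_sq
    have htm := h.card_le_sq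
    have hdich := hbound p A Γ ξ c h hΓ
    rw [h.addEnergy_eq]
    generalize ((elems Γ).card : ℝ) = t at *
    generalize ((elems A).card : ℝ) = m at *
    generalize Real.logb 2 m = l at *
    have ht0 : 0 < t := by linarith
    have hctm : c * t ≤ m ^ 2 := by linarith
    -- The energy is m² + c²t. The first estimate handles m², and t times the second handles c²t;
    -- hence the factor 2 in the constant.
    suffices hsuff : m ^ 2 * p ≤ (C + M ^ 2 * P) * (t * m ^ 2 * l) ∧
        c ^ 2 * p ≤ (C + M ^ 2 * P) * (m ^ 2 * l) by
      obtain ⟨hs1, hs2⟩ := hsuff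
      have hpos : 0 ≤ (C + M ^ 2 * P) * (m ^ 2 * l) := by positivity
      constructor
      · have e : (2 * C + 2 * M ^ 2 * P) * (t / p * m ^ 2 * l) =
            (2 * C + 2 * M ^ 2 * P) * (t * m ^ 2 * l) / p := by ring
        rw [e, le_div_iff₀ hp0]
        have h3 := mul_le_mul_of_nonneg_left hs2 ht0.le
        linarith
      · rw [← mul_div_assoc, le_div_iff₀ hp0]
        linarith
    have hC0 : 0 < C := by linarith
    have hM0 : 0 < M := by linarith
    rcases hdich with hm | hm
    · have hpP : (p : ℝ) ≤ P := by
        have h1 : δ * (√(p : ℝ) / 4) ≤ M ^ 2 := by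
          calc δ * (√(p : ℝ) / 4) ≤ δ * (p / Real.logb 2 (p : ℝ)) := by
                refine mul_le_mul_of_nonneg_left ?_ hδ.le
                rw [le_div_iff₀ hlogp0]
                have h2 := logb_two_le_four_mul_sqrt (x := (p : ℝ)) (by linarith)
                calc √(p : ℝ) / 4 * Real.logb 2 (p : ℝ) ≤ √(p : ℝ) / 4 * (4 * √(p : ℝ)) := by
                      gcongr
                  _ = √(p : ℝ) * √(p : ℝ) := by ring
                  _ = p := Real.mul_self_sqrt hp0.le
            _ ≤ t := hδΓ
            _ ≤ m ^ 2 := htm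
            _ ≤ M ^ 2 := by gcongr
        have h2 : √(p : ℝ) ≤ 4 * M ^ 2 / δ := by
          rw [le_div_iff₀ hδ]
          linarith
        calc (p : ℝ) = √(p : ℝ) ^ 2 := (Real.sq_sqrt hp0.le).symm
          _ ≤ P := pow_le_pow_left₀ (Real.sqrt_nonneg _) h2 2
      have hM1 : 1 ≤ M ^ 2 := one_le_pow₀ hM
      constructor
      · calc m ^ 2 * p = (1 * p) * (1 * m ^ 2 * 1) := by ring
          _ ≤ (M ^ 2 * P) * (t * m ^ 2 * l) := by gcongr
          _ ≤ _ := by gcongr; linarith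
      · have hcm : c ≤ m ^ 2 := le_trans (by nlinarith) hctm
        calc c ^ 2 * p ≤ (m ^ 2) ^ 2 * p := by gcongr
          _ = (m ^ 2 * p) * (m ^ 2 * 1) := by ring
          _ ≤ (M ^ 2 * P) * (m ^ 2 * l) := by gcongr
          _ ≤ _ := by gcongr; linarith
    · constructor
      · have h1 : t * p ≤ t * (C * t * l) := by
          calc t * p ≤ m ^ 2 * p := by gcongr
            _ = p * m ^ 2 := mul_comm _ _
            _ ≤ _ := hm
            _ = _ := by ring
        have h2 := le_of_mul_le_mul_left h1 ht0
        calc m ^ 2 * p ≤ m ^ 2 * (C * t * l) := by gcongr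
          _ = C * (t * m ^ 2 * l) := by ring
          _ ≤ _ := by
              gcongr
              have : 0 < M ^ 2 * P := by positivity
              linarith
      -- Multiplying by t² allows ct ≤ m² to be used; the dichotomy then bounds the remaining factor
      -- pm².
      · have h1 : t ^ 2 * (c ^ 2 * p) ≤ t ^ 2 * (C * (m ^ 2 * l)) := by
          calc t ^ 2 * (c ^ 2 * p) = (c * t) ^ 2 * p := by ring
            _ ≤ (m ^ 2) ^ 2 * p := by gcongr
            _ = m ^ 2 * (p * m ^ 2) := by ring
            _ ≤ m ^ 2 * (C * t ^ 2 * l) := by gcongr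
            _ = _ := by ring
        refine (le_of_mul_le_mul_left h1 (by positivity)).trans ?_
        gcongr
        have : 0 < M ^ 2 * P := by positivity
        linarith
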